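/- There is an absolute constant $C>0$ such that the following holds. Let $n\ge 2$, let $\Theta$ be a finite set of $N$ features, let $\bar H\in\mathbb R^{n\times n}$ be symmetric positive definite (the prior information matrix), and let the information matrix of each feature $f\in\Theta$ be $$H^f=\sigma^{-2}\bigl(F_f^TF_f-F_f^TE_f(E_f^TE_f)^{-1}E_f^TF_f\bigr),$$ where $\sigma>0$, $F_f\in\mathbb R^{m_f\times n}$, $E_f\in\mathbb R^{m_f\times 3}$ and $E_f^TE_f$ is invertible. For $\Phi\subseteq\Theta$ put $H(\Phi)=\bar H+\sum_{f\in\Phi}H^f$. Put $\bar H^f=\frac1N\bar H+H^f$, let $r_f=\mathrm{Tr}\bigl(H(\Theta)^{-1}\bar H^f\bigr)$ be the leverage scores, and let $\pi_f=r_f/n$; these numbers are a probability distribution on $\Theta$. Fix decompositions $\bar H^f=\sum_{i=1}^n h^{f,i}(h^{f,i})^T$ with $h^{f,1},\dots,h^{f,n}\in\mathbb R^n$ pairwise orthogonal, and put $\pi_{fi}=\frac1n\mathrm{Tr}\bigl(H(\Theta)^{-1}h^{f,i}(h^{f,i})^T\bigr)$ and $p_{fi}=\pi_{fi}/\sum_j\pi_{fj}$.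 Draw $q$ pairs $(f,i)$ independently with replacement, each by sampling $f$ with probability $\pi_f$ and then $i$ with probability $p_{fi}$. Let $\hat\Phi$ be the set of drawn pairs, let $w(f,i)$ be the number of times $(f,i)$ is drawn divided by $q\pi_{fi}$, and let $$\chi=\inf\Bigl\{\gamma>0:\ \sum_{(f,i)\in\hat\Phi}w(f,i)\bigl(\gamma-w(f,i)\bigr)h^{f,i}(h^{f,i})^T\succeq 0\Bigr\},\qquad \bar\chi=\mathbb E\,\chi .$$ Let $\epsilon\in(0,1)$ and let $q$ be an integer with $C\,n\log n/\epsilon^2\le q<N$ (for example $q=\lceil C\,n\log n/\epsilon^2\rceil=O(n\log n/\epsilon^2)$, if this is less than $N$). Sample $q$ features independently with replacement from $\Theta$ according to $\pi$, starting from $\Phi=\varnothing$ and adding each sampled feature to $\Phi$ unless it is already there. Then $\bar\chi>0$ and, with probability at least $1/4$, the resulting set $\Phi$ of selected features satisfies $$H(\Phi)\ \succeq\ \frac{1-\epsilon}{4\bar\chi}\,H(\Theta).$$ -/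

import Mathlib

open MeasureTheory ProbabilityTheory

noncomputable section

namespace FeatureSelection

variable {Θ : Type*} {n : ℕ}

/-- The information `σ⁻² (FᵀF - FᵀE (EᵀE)⁻¹ EᵀF)` contributed by a feature with (unknown) position
`y ∈ ℝ³` that is observed through `z = F x + E y + η`, where `x ∈ ℝⁿ` is the state and the
components of the noise `η` have variance `σ²`. -/
def featureInfo {m : ℕ} (σ : ℝ) (F : Matrix (Fin m) (Fin n) ℝ) (E : Matrix (Fin m) (Fin 3) ℝ) :
    Matrix (Fin n) (Fin n) ℝ :=
  (σ ^ 2)⁻¹ • (F.transpose * F - F.transpose * E * (E.transpose * E)⁻¹ * E.transpose * F)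

/-- The information matrix `H(Φ) = H₀ + ∑_{f ∈ Φ} H_f` of a set `Φ` of features, where `H₀` is the
prior information matrix. -/
def infoMatrix (H₀ : Matrix (Fin n) (Fin n) ℝ) (H : Θ → Matrix (Fin n) (Fin n) ℝ) (Φ : Finset Θ) :
    Matrix (Fin n) (Fin n) ℝ :=
  H₀ + ∑ f ∈ Φ, H f

section Scores

variable [Fintype Θ]

/-- `(1 / N) H₀ + H_f`, where `N` is the number of available features. -/
def barInfo (H₀ : Matrix (Fin n) (Fin n) ℝ) (H : Θ → Matrix (Fin n) (Fin n) ℝ) (f : Θ) :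
    Matrix (Fin n) (Fin n) ℝ :=
  (1 / (Fintype.card Θ : ℝ)) • H₀ + H f

/-- The leverage score `r_f = Tr (H(Θ)⁻¹ ((1 / N) H₀ + H_f))`. -/
def leverage (H₀ : Matrix (Fin n) (Fin n) ℝ) (H : Θ → Matrix (Fin n) (Fin n) ℝ) (f : Θ) : ℝ :=
  ((infoMatrix H₀ H Finset.univ)⁻¹ * barInfo H₀ H f).trace

/-- The sampling probability `π_f = r_f / n`. -/
def sampleProb (H₀ : Matrix (Fin n) (Fin n) ℝ) (H : Θ → Matrix (Fin n) (Fin n) ℝ) (f : Θ) : ℝ :=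
  leverage H₀ H f / n

end Scores

section Algorithm

variable [DecidableEq Θ]

/-- One iteration of the selection algorithm: if the sampled feature `f` is not selected yet, it is
added to the selected set and its matrix is added to the information matrix. -/
def selectStep (H : Θ → Matrix (Fin n) (Fin n) ℝ) (st : Finset Θ × Matrix (Fin n) (Fin n) ℝ)
    (f : Θ) : Finset Θ × Matrix (Fin n) (Fin n) ℝ :=
  if f ∈ st.1 then st else (insert f st.1, st.2 + H f)

/-- The output (selected features, information matrix) of the randomized feature selection
algorithm when the successively sampled features are `s 0, …, s (q - 1)`. -/
def select {q : ℕ} (H₀ : Matrix (Fin n) (Fin n) ℝ) (H : Θ → Matrix (Fin n) (Fin n) ℝ)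
    (s : Fin q → Θ) : Finset Θ × Matrix (Fin n) (Fin n) ℝ :=
  (List.ofFn s).foldl (selectStep H) (∅, H₀)

/-- The matrix maintained by the algorithm is the information matrix of the selected features. -/
theorem select_snd {q : ℕ} (H₀ : Matrix (Fin n) (Fin n) ℝ) (H : Θ → Matrix (Fin n) (Fin n) ℝ)
    (s : Fin q → Θ) : (select H₀ H s).2 = infoMatrix H₀ H (select H₀ H s).1 := by
  have key : ∀ (l : List Θ) (st : Finset Θ × Matrix (Fin n) (Fin n) ℝ),
      st.2 = infoMatrix H₀ H st.1 →
        (l.foldl (selectStep H) st).2 = infoMatrix H₀ H (l.foldl (selectStep H) st).1 := by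
    intro l
    induction l with
    | nil => intro st h; simpa using h
    | cons a l ih =>
      intro st h
      rw [List.foldl_cons]
      apply ih
      unfold selectStep
      split_ifs with ha
      · exact h
      · simp only [infoMatrix] at h ⊢
        rw [Finset.sum_insert ha, h]
        abel
  exact key _ _ (by simp [infoMatrix])

end Algorithm

section Spread

/-- `h` decomposes each matrix `(1 / N) H₀ + H_f` as `∑ᵢ h_{f,i} h_{f,i}ᵀ` with pairwise orthogonal
vectors `h_{f,1}, …, h_{f,n}`. -/
def IsOrthogonalDecomposition [Fintype Θ] (H₀ : Matrix (Fin n) (Fin n) ℝ)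
    (H : Θ → Matrix (Fin n) (Fin n) ℝ) (h : Θ → Fin n → Fin n → ℝ) : Prop :=
  ∀ f, (∀ i j, i ≠ j → h f i ⬝ᵥ h f j = 0) ∧
    barInfo H₀ H f = ∑ i, Matrix.vecMulVec (h f i) (h f i)

variable [Fintype Θ] (H₀ : Matrix (Fin n) (Fin n) ℝ) (H : Θ → Matrix (Fin n) (Fin n) ℝ)
  (h : Θ → Fin n → Fin n → ℝ)

/-- The refined leverage score `r_{fi} = Tr (H(Θ)⁻¹ h_{f,i} h_{f,i}ᵀ)`. -/
def refinedLeverage (f : Θ) (i : Fin n) : ℝ :=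
  ((infoMatrix H₀ H Finset.univ)⁻¹ * Matrix.vecMulVec (h f i) (h f i)).trace

/-- The refined sampling probability `π_{fi} = r_{fi} / n`. -/
def refinedProb (f : Θ) (i : Fin n) : ℝ :=
  refinedLeverage H₀ H h f i / n

/-- The probability `p_{fi} = π_{fi} / ∑ⱼ π_{fj}` of drawing the index `i` once the feature `f` has
been sampled. -/
def indexProb (f : Θ) (i : Fin n) : ℝ :=
  refinedProb H₀ H h f i / ∑ j, refinedProb H₀ H h f j

variable [DecidableEq Θ]

/-- The final weight of `(f, i)` when the weights start at `0` and `(q π_{fi})⁻¹` is added to the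
weight of `(f, i)` each time this pair is drawn; `s 0, …, s (q - 1)` are the drawn pairs. -/
def weight {q : ℕ} (s : Fin q → Θ × Fin n) (x : Θ × Fin n) : ℝ :=
  ((Finset.univ.filter fun k => s k = x).card : ℝ) * (q * refinedProb H₀ H h x.1 x.2)⁻¹

/-- The weight spread: the infimum of the `γ > 0` for which
`∑ w(f,i) (γ - w(f,i)) h_{f,i} h_{f,i}ᵀ` is positive semidefinite, the sum being over the set of
all pairs `(f, i)` that have been drawn. -/
def chi {q : ℕ} (s : Fin q → Θ × Fin n) : ℝ :=
  sInf {γ : ℝ | 0 < γ ∧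
    (∑ x ∈ Finset.univ.image s, (weight H₀ H h s x * (γ - weight H₀ H h s x)) •
      Matrix.vecMulVec (h x.1 x.2) (h x.1 x.2)).PosSemidef}

/-- The expectation of the weight spread when `q` pairs `(f, i)` are drawn independently with
replacement, each by sampling `f` with probability `π_f` and then `i` with probability `p_{fi}`. -/
def chiBar (q : ℕ) : ℝ :=
  ∑ s : Fin q → Θ × Fin n,
    (∏ k, sampleProb H₀ H (s k).1 * indexProb H₀ H h (s k).1 (s k).2) * chi H₀ H h s

end Spread

end FeatureSelection

end

open FeatureSelection

/-!
Write `A = H(Θ)`. The pairs `x = (f, i)` are drawn with probabilities `π x` proportional to the leverage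
scores of the rank-one summands of `A = ∑ x, h x (h x)ᵀ`, and the features sampled by the algorithm may
be taken to be their first components. Three facts give the result.

* Leverage score sampling (`sum_filter_not_leverage_lower_bound_le`): with probability at least `1 / 2`,
  `∑ w x h x (h x)ᵀ ⪰ (1 - ε) A`, the sum being over the drawn pairs.
* Removal of the weights (`sum_weight_mul_le_chi_mul`): by Cauchy–Schwarz and the definition of `chi`,
  `∑ w x h x (h x)ᵀ ⪯ chi • ∑ h x (h x)ᵀ`. By Markov's inequality `chi < 4 * chiBar` with probability at
  least `3 / 4`.
* Comparison (`sum_vecMulVec_quadratic_le`): `∑ h x (h x)ᵀ ⪯ H(Φ)`, because each selected feature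
  contributes only the share `1 / N` of the prior.

For the first fact, normalise to `A = 1`; the sum is then `q⁻¹ Y`, where `Y` is a sum of `q` independent
matrices `g gᵀ` with `E g gᵀ = 1` and `|g|² ≤ n`. Instead of matrix exponentials and the Golden–Thompson
inequality, the proof follows the potential `tr Z⁻ᵐ` of `Z = K + Y` with `m` a power of two of order
`log n / ε` and `K` of order `m n / ε`. By the Sherman–Morrison formula an update of `Z` multiplies `Z⁻¹`,
up to congruence, by a matrix `1 - s w wᵀ`. An elementary trace inequality of Araki–Lieb–Thirring type
(`trace_pow_two_pow_le`) then shows that the potential decreases in expectation by about `m tr Z⁻⁽ᵐ⁺¹⁾`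
(`trace_rank_one_downdate_pow_le`), just as if `Z` were increased by `1 - ε / 4`. Hence the expected
potential after `q` steps is at most `n (K + (1 - ε / 4) q)⁻ᵐ` (`sum_prod_mul_trace_inv_pow_le`), and
Markov's inequality bounds the smallest eigenvalue of `Z`, because `(2 n) ^ (1 / m)` is close to `1`.
-/

namespace FeatureSelection

/-! ### Trace inequalities -/

section TraceInequalities

open Matrix

variable {ι : Type*} [Fintype ι]

theorem trace_mul_transpose_nonneg (A : Matrix ι ι ℝ) : 0 ≤ (A * Aᵀ).trace := by
  simp only [trace, diag_apply, mul_apply, transpose_apply]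
  exact Finset.sum_nonneg fun i _ => Finset.sum_nonneg fun j _ => mul_self_nonneg _

/-- Cauchy–Schwarz for the Frobenius inner product, in the form `2⟨A, B⟩ ≤ ⟨A, A⟩ + ⟨B, B⟩`. -/
theorem two_mul_trace_mul_transpose_le (A B : Matrix ι ι ℝ) :
    2 * (A * Bᵀ).trace ≤ (A * Aᵀ).trace + (B * Bᵀ).trace := by
  have h := trace_mul_transpose_nonneg (A - B)
  have h2 : (B * Aᵀ).trace = (A * Bᵀ).trace := by
    rw [← trace_transpose, transpose_mul, transpose_transpose]
  rw [transpose_sub, sub_mul, mul_sub, mul_sub, trace_sub, trace_sub, trace_sub, h2] at h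
  linarith

theorem trace_vecMulVec_mul (v : ι → ℝ) (A : Matrix ι ι ℝ) :
    (vecMulVec v v * A).trace = v ⬝ᵥ A *ᵥ v := by
  rw [trace_mul_comm, mul_vecMulVec, trace_vecMulVec, dotProduct_comm]

variable [DecidableEq ι]

theorem trace_mul_pow_comm (A B : Matrix ι ι ℝ) (m : ℕ) :
    ((A * B) ^ m).trace = ((B * A) ^ m).trace := by
  cases m with
  | zero => simp
  | succ m =>
    have h : A * (B * A) ^ m = (A * B) ^ m * A :=
      (show SemiconjBy A (B * A) (A * B) by simp [SemiconjBy, mul_assoc]).pow_right m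
    rw [pow_succ, ← mul_assoc, ← h, mul_assoc, Matrix.trace_mul_comm, pow_succ, mul_assoc]

/-- A Weyl type inequality `tr X^(2m) ≤ tr (X Xᵀ)^m` and an Araki–Lieb–Thirring type inequality
`tr (A B)^m ≤ tr (A^m B^m)` for symmetric `A`, `B`, where `m` is a power of two. The exponent doubles
in each step of a simultaneous induction: the first inequality for `X` follows from both for `X ^ 2`
and `X Xᵀ`, `Xᵀ X`, the second for `A`, `B` from the first for `A B` and the second for `A ^ 2`,
`B ^ 2`. -/
theorem trace_pow_two_pow_le (k : ℕ) :
    (∀ X : Matrix ι ι ℝ, (X ^ 2 ^ (k + 1)).trace ≤ ((X * Xᵀ) ^ 2 ^ k).trace) ∧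
    ∀ A B : Matrix ι ι ℝ, Aᵀ = A → Bᵀ = B →
      ((A * B) ^ 2 ^ k).trace ≤ (A ^ 2 ^ k * B ^ 2 ^ k).trace := by
  induction k with
  | zero =>
    refine ⟨fun X => ?_, fun A B _ _ => by simp⟩
    have h := two_mul_trace_mul_transpose_le X Xᵀ
    rw [transpose_transpose, trace_mul_comm Xᵀ X] at h
    simp only [zero_add, pow_one, pow_zero, pow_two]
    linarith
  | succ k ih =>
    obtain ⟨ih₁, ih₂⟩ := ih
    have hsymm : ∀ (A : Matrix ι ι ℝ) (m : ℕ), Aᵀ = A → (A ^ m)ᵀ = A ^ m := fun A m h => by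
      rw [transpose_pow, h]
    have hsq : ∀ A : Matrix ι ι ℝ, A ^ 2 ^ (k + 1) = A ^ 2 ^ k * A ^ 2 ^ k := fun A => by
      rw [← pow_add, pow_succ, mul_two]
    constructor
    · intro X
      have hQ : (X * Xᵀ)ᵀ = X * Xᵀ := by simp
      have hP : (Xᵀ * X)ᵀ = Xᵀ * X := by simp
      have h1 := ih₁ (X ^ 2)
      have h2 : ((X ^ 2 * (X ^ 2)ᵀ) ^ 2 ^ k).trace = ((X * Xᵀ * (Xᵀ * X)) ^ 2 ^ k).trace := by
        rw [show X ^ 2 * (X ^ 2)ᵀ = X * (X * Xᵀ * Xᵀ) by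
          rw [pow_two, transpose_mul]; simp only [mul_assoc], trace_mul_pow_comm]
        simp only [mul_assoc]
      have h3 := ih₂ _ _ hQ hP
      have h4 := two_mul_trace_mul_transpose_le ((X * Xᵀ) ^ 2 ^ k) ((Xᵀ * X) ^ 2 ^ k)
      rw [hsymm _ _ hQ, hsymm _ _ hP, ← hsq, ← hsq, trace_mul_pow_comm Xᵀ X] at h4
      rw [← pow_mul, ← pow_succ'] at h1
      linarith
    · intro A B hA hB
      have h1 := ih₁ (A * B)
      have h2 : ((A * B * (A * B)ᵀ) ^ 2 ^ k).trace = ((A ^ 2 * B ^ 2) ^ 2 ^ k).trace := by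
        rw [show A * B * (A * B)ᵀ = A * (B ^ 2 * A) by
          rw [transpose_mul, hA, hB, pow_two]; simp only [mul_assoc], trace_mul_pow_comm,
          mul_assoc, ← pow_two, trace_mul_pow_comm]
      have h3 := ih₂ (A ^ 2) (B ^ 2) (hsymm _ _ hA) (hsymm _ _ hB)
      rw [← pow_mul, ← pow_mul, ← pow_succ'] at h3
      linarith

/-- A power of `1 - s w wᵀ` is `1 - c w wᵀ`; the lower bound for `c` is first order in `m s` with a
quadratic error. The other two bounds for `c` make the induction on `m` go through. -/
theorem one_sub_smul_vecMulVec_pow (w : ι → ℝ) (s : ℝ) (hs0 : 0 ≤ s) (hs : s * (w ⬝ᵥ w) ≤ 1)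
    (m : ℕ) :
    ∃ c : ℝ, 0 ≤ c ∧ c ≤ m * s ∧ m * s - m ^ 2 * s ^ 2 * (w ⬝ᵥ w) ≤ c ∧
      (1 - s • vecMulVec w w) ^ m = 1 - c • vecMulVec w w := by
  have ht : 0 ≤ w ⬝ᵥ w := Finset.sum_nonneg fun i _ => mul_self_nonneg _
  induction m with
  | zero => exact ⟨0, by simp⟩
  | succ m ih =>
    obtain ⟨c, h0, h1, h2, h3⟩ := ih
    refine ⟨c + s - c * (s * (w ⬝ᵥ w)), ?_, ?_, ?_, ?_⟩
    · nlinarith [mul_le_mul_of_nonneg_left hs h0]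
    · have : 0 ≤ c * (s * (w ⬝ᵥ w)) := by positivity
      push_cast; linarith
    · have h4 : c * (s * (w ⬝ᵥ w)) ≤ m * s * (s * (w ⬝ᵥ w)) := by gcongr
      have h5 : 0 ≤ (m + 1) * (s ^ 2 * (w ⬝ᵥ w)) := by positivity
      push_cast
      nlinarith
    · have hww : vecMulVec w w * vecMulVec w w = (w ⬝ᵥ w) • vecMulVec w w := by
        rw [vecMulVec_mul_vecMulVec]
        simp [vecMulVec_smul]
      rw [pow_succ, h3, sub_mul, one_mul, mul_sub, mul_one, smul_mul_smul_comm, hww]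
      module

open scoped Matrix.Norms.L2Operator MatrixOrder in
theorem exists_eq_transpose_mul_self {P : Matrix ι ι ℝ} (hP : P.PosSemidef) :
    ∃ S : Matrix ι ι ℝ, P = Sᵀ * S := by
  obtain ⟨S, hS⟩ := CStarAlgebra.nonneg_iff_eq_star_mul_self.mp hP.nonneg
  exact ⟨S, hS⟩

/-- If `P = Z⁻¹`, the matrix on the left is `(Z + v vᵀ)⁻¹` (see `inv_add_vecMulVec`), so this bounds the
potential `tr Z⁻ᵐ`, `m = 2 ^ k`, after a rank-one update of `Z`. With `P = Sᵀ S` and `w = S v`, that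
matrix is `Sᵀ (1 - s w wᵀ) S`, and `trace_pow_two_pow_le` separates the powers of the two factors
`1 - s w wᵀ` and `S Sᵀ`. -/
theorem trace_rank_one_downdate_pow_le {P : Matrix ι ι ℝ} (hP : P.PosSemidef) (v : ι → ℝ) (k : ℕ)
    {τ : ℝ} (hτ : v ⬝ᵥ P *ᵥ v ≤ τ) :
    ((P - (1 + v ⬝ᵥ P *ᵥ v)⁻¹ • (P * vecMulVec v v * P)) ^ 2 ^ k).trace ≤
      (P ^ 2 ^ k).trace -
        (2 ^ k : ℝ) * (1 - (2 ^ k + 1) * τ) * (v ⬝ᵥ P ^ (2 ^ k + 1) *ᵥ v) := by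
  obtain ⟨S, rfl⟩ := exists_eq_transpose_mul_self hP
  set w := S *ᵥ v with hw
  have ht : v ⬝ᵥ (Sᵀ * S) *ᵥ v = w ⬝ᵥ w := by
    rw [← mulVec_mulVec, mulVec_transpose, dotProduct_comm, ← dotProduct_mulVec]
  rw [ht] at hτ ⊢
  set t := w ⬝ᵥ w with htdef
  have ht0 : 0 ≤ t := Finset.sum_nonneg fun i _ => mul_self_nonneg _
  set s := (1 + t)⁻¹ with hs
  have hs0 : 0 ≤ s := by positivity
  have hst : s + s * t = 1 := by rw [hs]; field_simp
  obtain ⟨c, -, -, hc, hB⟩ := one_sub_smul_vecMulVec_pow w s hs0 (by linarith) (2 ^ k)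
  have hfac : Sᵀ * S - s • (Sᵀ * S * vecMulVec v v * (Sᵀ * S)) =
      Sᵀ * ((1 - s • vecMulVec w w) * S) := by
    have : vecMulVec w w = S * vecMulVec v v * Sᵀ := by
      rw [mul_vecMulVec, vecMulVec_mul, vecMul_transpose]
    simp only [this, sub_mul, mul_sub, one_mul, smul_mul_assoc, mul_smul_comm, mul_assoc]
  have hquad : w ⬝ᵥ (S * Sᵀ) ^ 2 ^ k *ᵥ w = v ⬝ᵥ (Sᵀ * S) ^ (2 ^ k + 1) *ᵥ v := by
    have h : Sᵀ * (S * Sᵀ) ^ 2 ^ k = (Sᵀ * S) ^ 2 ^ k * Sᵀ :=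
      (show SemiconjBy Sᵀ (S * Sᵀ) (Sᵀ * S) by simp [SemiconjBy, mul_assoc]).pow_right _
    rw [pow_succ, ← mul_assoc, ← h, hw, dotProduct_comm, dotProduct_mulVec, ← mulVec_transpose,
      dotProduct_comm, mulVec_mulVec, mulVec_mulVec]
  have hBsymm : (1 - s • vecMulVec w w)ᵀ = 1 - s • vecMulVec w w := by
    simp [transpose_vecMulVec]
  have halt := (trace_pow_two_pow_le k).2 _ (S * Sᵀ) hBsymm (by simp)
  rw [hB, sub_mul (1 : Matrix ι ι ℝ) (c • _), one_mul, smul_mul_assoc, trace_sub, trace_smul, trace_vecMulVec_mul, hquad,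
    trace_mul_pow_comm S] at halt
  have hq : 0 ≤ v ⬝ᵥ (Sᵀ * S) ^ (2 ^ k + 1) *ᵥ v := by
    simpa using (hP.pow (2 ^ k + 1)).dotProduct_mulVec_nonneg v
  rw [hfac, trace_mul_pow_comm, mul_assoc]
  refine halt.trans (sub_le_sub_left ?_ _)
  rw [smul_eq_mul]
  refine mul_le_mul_of_nonneg_right (le_trans ?_ hc) hq
  push_cast
  have hM : (0 : ℝ) ≤ 2 ^ k := by positivity
  have hs1 : s ≤ 1 := by nlinarith [mul_nonneg hs0 ht0]
  have h1 : s ^ 2 * t ≤ t := mul_le_of_le_one_left ht0 (pow_le_one₀ hs0 hs1)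
  have h2 : 1 - t ≤ s := by nlinarith [mul_le_mul_of_nonneg_right hs1 ht0]
  have h3 : (2 ^ k : ℝ) ^ 2 * (s ^ 2 * t) ≤ (2 ^ k : ℝ) ^ 2 * τ := by gcongr; linarith
  have h4 : (2 ^ k : ℝ) * (1 - τ) ≤ 2 ^ k * s := by gcongr; linarith
  linarith

theorem one_sub_nat_mul_mul_one_add_pow_le_one {z : ℝ} (hz : 0 ≤ z) (m : ℕ) :
    (1 - m * z) * (1 + z) ^ m ≤ 1 := by
  have h1 : 1 - m * z ≤ Real.exp (-(m * z)) := by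
    linarith [Real.add_one_le_exp (-(m * z))]
  have h2 : (1 + z) ^ m ≤ Real.exp (m * z) := by
    rw [Real.exp_nat_mul]
    gcongr
    linarith [Real.add_one_le_exp z]
  calc (1 - m * z) * (1 + z) ^ m ≤ Real.exp (-(m * z)) * Real.exp (m * z) := by gcongr
    _ = 1 := by rw [← Real.exp_add]; simp

/-- Weighted AM–GM for `x ^ (m + 1)` and `y ^ (m + 1)`. -/
theorem succ_mul_pow_mul_le {x y : ℝ} (hx : 0 ≤ x) (hy : 0 ≤ y) (m : ℕ) :
    (m + 1) * y * x ^ m ≤ m * x ^ (m + 1) + y ^ (m + 1) := by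
  induction m with
  | zero => simp
  | succ m ih =>
    have h1 : 0 ≤ (m + 1) * x ^ m * (x - y) ^ 2 := by positivity
    have h2 := mul_le_mul_of_nonneg_left ih hy
    push_cast
    have e : ((m : ℝ) + 1) * x ^ (m + 1 + 1) + y ^ (m + 1 + 1) - (m + 1 + 1) * y * x ^ (m + 1) =
      (m + 1) * x ^ m * (x - y) ^ 2 + (y * (m * x ^ (m + 1) + y ^ (m + 1)) -
        y * ((m + 1) * y * x ^ m)) := by ring
    linarith

/-- The spectral theorem for all powers of a positive semidefinite matrix at once. -/
theorem exists_eq_mul_diagonal_mul_transpose {P : Matrix ι ι ℝ} (hP : P.PosSemidef) :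
    ∃ (U : Matrix ι ι ℝ) (d : ι → ℝ), Uᵀ * U = 1 ∧ U * Uᵀ = 1 ∧ (∀ i, 0 ≤ d i) ∧
      ∀ m, P ^ m = U * diagonal (fun i => d i ^ m) * Uᵀ := by
  have h1 : (hP.1.eigenvectorUnitary : Matrix ι ι ℝ)ᵀ * hP.1.eigenvectorUnitary = 1 :=
    Unitary.coe_star_mul_self hP.1.eigenvectorUnitary
  have h2 : (hP.1.eigenvectorUnitary : Matrix ι ι ℝ) * (hP.1.eigenvectorUnitary : Matrix ι ι ℝ)ᵀ = 1 :=
    Unitary.coe_mul_star_self hP.1.eigenvectorUnitary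
  have hs : P = hP.1.eigenvectorUnitary * diagonal hP.1.eigenvalues *
      (hP.1.eigenvectorUnitary : Matrix ι ι ℝ)ᵀ := by
    conv_lhs => rw [hP.1.spectral_theorem, Unitary.conjStarAlgAut_apply]
    rfl
  refine ⟨hP.1.eigenvectorUnitary, hP.1.eigenvalues, h1, h2, hP.eigenvalues_nonneg, ?_⟩
  generalize (hP.1.eigenvectorUnitary : Matrix ι ι ℝ) = U at *
  generalize hP.1.eigenvalues = d at *
  subst hs
  intro m
  induction m with
  | zero => simp [h2]
  | succ m ih =>
    rw [pow_succ, ih]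
    calc _ = U * diagonal (fun i => d i ^ m) * (Uᵀ * U) * diagonal d * Uᵀ := by
          simp only [mul_assoc]
      _ = _ := by
        rw [h1, mul_one, mul_assoc U, diagonal_mul_diagonal]
        simp only [pow_succ]

/-- For every `y`, a bound of `tr P^(m+1)` from below by an affine function of `tr P^m`. Being affine, it
survives taking expectations of `P`, with `y` deterministic. -/
theorem succ_mul_trace_pow_le {P : Matrix ι ι ℝ} (hP : P.PosSemidef) {y : ℝ} (hy : 0 ≤ y) (m : ℕ) :
    (m + 1) * y * (P ^ m).trace ≤ m * (P ^ (m + 1)).trace + Fintype.card ι * y ^ (m + 1) := by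
  obtain ⟨U, d, h1, -, hd, hpow⟩ := exists_eq_mul_diagonal_mul_transpose hP
  have htr : ∀ m, (P ^ m).trace = ∑ i, d i ^ m := fun m => by
    rw [hpow, trace_mul_comm, ← mul_assoc, h1, one_mul, trace_diagonal]
  rw [htr, htr, Finset.mul_sum, Finset.mul_sum, ← nsmul_eq_mul, ← Finset.card_univ,
    ← Finset.sum_const, ← Finset.sum_add_distrib]
  exact Finset.sum_le_sum fun i _ => succ_mul_pow_mul_le (hd i) hy m

theorem dotProduct_mulVec_le_of_trace_pow_le {P : Matrix ι ι ℝ} (hP : P.PosSemidef) {m : ℕ}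
    (hm : m ≠ 0) {ρ : ℝ} (hρ : 0 ≤ ρ) (htr : (P ^ m).trace ≤ ρ ^ m) (v : ι → ℝ) :
    v ⬝ᵥ P *ᵥ v ≤ ρ * (v ⬝ᵥ v) := by
  obtain ⟨U, d, h1, h2, hd, hpow⟩ := exists_eq_mul_diagonal_mul_transpose hP
  rw [hpow, trace_mul_comm, ← mul_assoc, h1, one_mul, trace_diagonal] at htr
  have hdρ : ∀ i, d i ≤ ρ := fun i => by
    refine le_of_pow_le_pow_left₀ hm hρ (le_trans ?_ htr)
    exact Finset.single_le_sum (f := fun i => d i ^ m) (fun j _ => pow_nonneg (hd j) m)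
      (Finset.mem_univ i)
  have hquad : ∀ D : Matrix ι ι ℝ, v ⬝ᵥ (U * D * Uᵀ) *ᵥ v = (Uᵀ *ᵥ v) ⬝ᵥ D *ᵥ (Uᵀ *ᵥ v) := fun D => by
    rw [mul_assoc, ← mulVec_mulVec, dotProduct_mulVec, ← mulVec_transpose, ← mulVec_mulVec]
  have hv : v ⬝ᵥ v = (Uᵀ *ᵥ v) ⬝ᵥ (Uᵀ *ᵥ v) := by
    have := hquad 1
    rw [mul_one, h2, one_mulVec, one_mulVec] at this
    exact this
  have h := hquad (diagonal d)
  have hP1 := hpow 1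
  simp only [pow_one] at hP1
  rw [hP1, h, hv, dotProduct, dotProduct, Finset.mul_sum]
  refine Finset.sum_le_sum fun i _ => ?_
  rw [mulVec_diagonal]
  nlinarith [mul_le_mul_of_nonneg_right (hdρ i) (mul_self_nonneg ((Uᵀ *ᵥ v) i))]

/-- A bound on the potential `tr Z⁻ᵐ` bounds the smallest eigenvalue of `Z` from below. -/
theorem le_mul_dotProduct_mulVec_of_trace_inv_pow_le {Z : Matrix ι ι ℝ} (hZ : Z.PosDef) {m : ℕ}
    (hm : m ≠ 0) {ρ : ℝ} (hρ : 0 < ρ) (htr : (Z⁻¹ ^ m).trace ≤ ρ ^ m) (v : ι → ℝ) :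
    v ⬝ᵥ v ≤ ρ * (v ⬝ᵥ Z *ᵥ v) := by
  have hP := hZ.inv.posSemidef
  have h1 := dotProduct_mulVec_le_of_trace_pow_le hP hm hρ.le htr v
  have h2 := hP.dotProduct_mulVec_nonneg (v - ρ • Z *ᵥ v)
  have hdet : IsUnit Z.det := hZ.isUnit.map detMonoidHom
  have e1 : Z⁻¹ *ᵥ (Z *ᵥ v) = v := by
    rw [mulVec_mulVec, nonsing_inv_mul _ hdet, one_mulVec]
  have hsymm : Z⁻¹ᵀ = Z⁻¹ := hP.1
  have e2 : (Z *ᵥ v) ⬝ᵥ Z⁻¹ *ᵥ v = v ⬝ᵥ v := by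
    rw [dotProduct_mulVec, ← mulVec_transpose, hsymm, e1]
  simp only [star_trivial, mulVec_sub, mulVec_smul, e1, sub_dotProduct, dotProduct_sub,
    smul_dotProduct, dotProduct_smul, smul_eq_mul, e2] at h2
  rw [dotProduct_comm (Z *ᵥ v) v] at h2
  have : 0 ≤ ρ * (ρ * (v ⬝ᵥ Z *ᵥ v) - v ⬝ᵥ v) := by nlinarith
  linarith [nonneg_of_mul_nonneg_right this hρ]

/-- The Sherman–Morrison formula for a symmetric rank-one update. -/
theorem inv_add_vecMulVec {Z : Matrix ι ι ℝ} (hZ : Z.PosDef) (v : ι → ℝ) :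
    (Z + vecMulVec v v)⁻¹ =
      Z⁻¹ - (1 + v ⬝ᵥ Z⁻¹ *ᵥ v)⁻¹ • (Z⁻¹ * vecMulVec v v * Z⁻¹) := by
  have ht : 0 ≤ v ⬝ᵥ Z⁻¹ *ᵥ v := hZ.inv.posSemidef.dotProduct_mulVec_nonneg v
  have hdet : IsUnit Z.det := hZ.isUnit.map detMonoidHom
  have h1 : Z * Z⁻¹ = 1 := mul_nonsing_inv _ hdet
  have h2 : vecMulVec v v * Z⁻¹ * vecMulVec v v = (v ⬝ᵥ Z⁻¹ *ᵥ v) • vecMulVec v v := by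
    rw [mul_assoc, mul_vecMulVec, vecMulVec_mul_vecMulVec]
    simp [vecMulVec_smul]
  apply inv_eq_right_inv
  set t := v ⬝ᵥ Z⁻¹ *ᵥ v
  set V := vecMulVec v v
  calc (Z + V) * (Z⁻¹ - (1 + t)⁻¹ • (Z⁻¹ * V * Z⁻¹))
      = Z * Z⁻¹ + V * Z⁻¹ - (1 + t)⁻¹ • (Z * Z⁻¹ * (V * Z⁻¹) + V * Z⁻¹ * V * Z⁻¹) := by
        simp only [mul_sub, add_mul, mul_smul_comm, smul_add, mul_assoc]
    _ = 1 := by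
      rw [h1, h2, one_mul, smul_mul_assoc, show V * Z⁻¹ + t • (V * Z⁻¹) = (1 + t) • (V * Z⁻¹) by module, smul_smul,
        inv_mul_cancel₀ (by positivity), one_smul, add_sub_cancel_right]

end TraceInequalities

/-! ### Lower tail of a sum of independent rank-one matrices -/

section Concentration

open Matrix

variable {ι : Type*} [Fintype ι]

theorem posSemidef_vecMulVec_self (v : ι → ℝ) : (vecMulVec v v).PosSemidef := by
  simpa using posSemidef_vecMulVec_self_star v

theorem dotProduct_vecMulVec_mulVec (u v : ι → ℝ) : v ⬝ᵥ vecMulVec u u *ᵥ v = (u ⬝ᵥ v) ^ 2 := by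
  rw [vecMulVec_mulVec, dotProduct_smul, dotProduct_comm v u]
  simp [pow_two]

variable [DecidableEq ι]

/-- If `Z ⪰ K` then `Z⁻¹ ⪯ K⁻¹`. -/
theorem mul_dotProduct_inv_mulVec_le {Z : Matrix ι ι ℝ} (hZ : Z.PosDef) {K : ℝ} (hK : 0 < K)
    (hZK : ∀ v, K * (v ⬝ᵥ v) ≤ v ⬝ᵥ Z *ᵥ v) (g : ι → ℝ) :
    K * (g ⬝ᵥ Z⁻¹ *ᵥ g) ≤ g ⬝ᵥ g := by
  have hdet : IsUnit Z.det := hZ.isUnit.map detMonoidHom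
  set y := Z⁻¹ *ᵥ g with hy
  have hZy : Z *ᵥ y = g := by rw [hy, mulVec_mulVec, mul_nonsing_inv _ hdet, one_mulVec]
  have h1 := hZK y
  rw [hZy, dotProduct_comm y g] at h1
  have h2 : 0 ≤ (g - K • y) ⬝ᵥ (g - K • y) := Finset.sum_nonneg fun i _ => mul_self_nonneg _
  simp only [sub_dotProduct, dotProduct_sub, smul_dotProduct, dotProduct_smul, smul_eq_mul] at h2
  rw [dotProduct_comm y g] at h2
  nlinarith [mul_le_mul_of_nonneg_left h1 hK.le]

variable {α : Type*} [Fintype α] {p : α → ℝ} {g : α → ι → ℝ}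

/-- Expected potential `tr Z⁻ᵐ`, `m = 2 ^ k`, after one random update `Z + g gᵀ` with `E g gᵀ = 1`. -/
theorem sum_mul_trace_inv_pow_le (hp : ∀ x, 0 ≤ p x) (hp1 : ∑ x, p x = 1)
    (hiso : ∑ x, p x • vecMulVec (g x) (g x) = 1) {r : ℝ} (hg : ∀ x, g x ⬝ᵥ g x ≤ r) {K : ℝ}
    (hK : 0 < K) {k : ℕ} {η : ℝ} (hη : (2 ^ k + 1) * (r / K) ≤ η) (hη1 : η ≤ 1)
    {Z : Matrix ι ι ℝ} (hZ : Z.PosDef) (hZK : ∀ v, K * (v ⬝ᵥ v) ≤ v ⬝ᵥ Z *ᵥ v)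
    {y : ℝ} (hy : 0 ≤ y) :
    ∑ x, p x * ((Z + vecMulVec (g x) (g x))⁻¹ ^ 2 ^ k).trace ≤
      (1 - (1 - η) * (2 ^ k + 1) * y) * (Z⁻¹ ^ 2 ^ k).trace +
        (1 - η) * (Fintype.card ι * y ^ (2 ^ k + 1)) := by
  have hP := hZ.inv.posSemidef
  have hstep : ∀ x, ((Z + vecMulVec (g x) (g x))⁻¹ ^ 2 ^ k).trace ≤
      (Z⁻¹ ^ 2 ^ k).trace - 2 ^ k * (1 - η) * (g x ⬝ᵥ Z⁻¹ ^ (2 ^ k + 1) *ᵥ g x) := fun x => by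
    have hτ : g x ⬝ᵥ Z⁻¹ *ᵥ g x ≤ r / K := by
      rw [le_div_iff₀ hK, mul_comm]
      exact (mul_dotProduct_inv_mulVec_le hZ hK hZK _).trans (hg x)
    rw [inv_add_vecMulVec hZ]
    refine (trace_rank_one_downdate_pow_le hP (g x) k hτ).trans (sub_le_sub_left ?_ _)
    have hq : 0 ≤ g x ⬝ᵥ Z⁻¹ ^ (2 ^ k + 1) *ᵥ g x := by
      simpa using (hP.pow (2 ^ k + 1)).dotProduct_mulVec_nonneg (g x)
    gcongr
  have hsum : ∑ x, p x * (g x ⬝ᵥ Z⁻¹ ^ (2 ^ k + 1) *ᵥ g x) = (Z⁻¹ ^ (2 ^ k + 1)).trace := by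
    have h : ∀ x, p x * (g x ⬝ᵥ Z⁻¹ ^ (2 ^ k + 1) *ᵥ g x) =
        (p x • vecMulVec (g x) (g x) * Z⁻¹ ^ (2 ^ k + 1)).trace := fun x => by
      rw [smul_mul_assoc, trace_smul, trace_vecMulVec_mul, smul_eq_mul]
    rw [Finset.sum_congr rfl fun x _ => h x, ← trace_sum, ← Finset.sum_mul, hiso, one_mul]
  have hamgm := succ_mul_trace_pow_le hP hy (2 ^ k)
  push_cast at hamgm
  calc ∑ x, p x * ((Z + vecMulVec (g x) (g x))⁻¹ ^ 2 ^ k).trace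
      ≤ ∑ x, p x * ((Z⁻¹ ^ 2 ^ k).trace -
          2 ^ k * (1 - η) * (g x ⬝ᵥ Z⁻¹ ^ (2 ^ k + 1) *ᵥ g x)) :=
        Finset.sum_le_sum fun x _ => mul_le_mul_of_nonneg_left (hstep x) (hp x)
    _ = (∑ x, p x) * (Z⁻¹ ^ 2 ^ k).trace -
          2 ^ k * (1 - η) * ∑ x, p x * (g x ⬝ᵥ Z⁻¹ ^ (2 ^ k + 1) *ᵥ g x) := by
        rw [Finset.sum_mul, Finset.mul_sum, ← Finset.sum_sub_distrib]
        exact Finset.sum_congr rfl fun x _ => by ring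
    _ ≤ _ := by
        rw [hp1, hsum]
        nlinarith [mul_le_mul_of_nonneg_left hamgm (sub_nonneg.mpr hη1)]

/-- Expected potential after `q` independent updates of `K • 1` by `g gᵀ`, where `E g gᵀ = 1` and
`g ⬝ᵥ g ≤ r`: it is at most the potential of `(K + (1 - η) q) • 1`. -/
theorem sum_prod_mul_trace_inv_pow_le (hp : ∀ x, 0 ≤ p x) (hp1 : ∑ x, p x = 1)
    (hiso : ∑ x, p x • vecMulVec (g x) (g x) = 1) {r : ℝ} (hg : ∀ x, g x ⬝ᵥ g x ≤ r) {K : ℝ}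
    (hK : 0 < K) {k : ℕ} {η : ℝ} (hη : (2 ^ k + 1) * (r / K) ≤ η) (hη0 : 0 ≤ η) (hη1 : η ≤ 1)
    (hKm : 2 ^ k + 1 ≤ K) (q : ℕ) :
    ∑ s : Fin q → α, (∏ j, p (s j)) *
        ((K • (1 : Matrix ι ι ℝ) + ∑ j, vecMulVec (g (s j)) (g (s j)))⁻¹ ^ 2 ^ k).trace ≤
      Fintype.card ι * ((K + (1 - η) * q)⁻¹) ^ 2 ^ k := by
  induction q with
  | zero =>
    have : (K • (1 : Matrix ι ι ℝ))⁻¹ = K⁻¹ • 1 := by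
      apply inv_eq_right_inv
      rw [smul_mul_smul_comm, mul_inv_cancel₀ hK.ne', one_smul, one_mul]
    simp [this, smul_pow, trace_smul, mul_comm]
  | succ q ih =>
    set b : ℝ := K + (1 - η) * q with hb
    have hη' : 0 ≤ 1 - η := by linarith
    have hbK : K ≤ b := by
      have : 0 ≤ (1 - η) * q := by positivity
      linarith
    have hb0 : 0 < b := hK.trans_le hbK
    -- `b` is the value with `E tr Z⁻ᵐ ≤ n b⁻ᵐ`; the affine lower bound for `tr Z⁻⁽ᵐ⁺¹⁾` is taken tangent
    -- at the corresponding eigenvalue `b⁻¹` of `Z⁻¹`.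
    set y := b⁻¹ with hy
    have hy0 : 0 ≤ y := by positivity
    have hby : b * y = 1 := mul_inv_cancel₀ hb0.ne'
    -- The coefficient of the current potential has to be nonnegative to insert the induction hypothesis.
    have hcoef : 0 ≤ 1 - (1 - η) * (2 ^ k + 1) * y := by
      have h1 : (2 ^ k + 1) * y ≤ 1 := by
        rw [← hby]; gcongr; linarith
      have h2 : (1 - η) * ((2 ^ k + 1) * y) ≤ 1 * 1 := by gcongr; linarith
      linarith
    have hprod : ∑ s : Fin q → α, ∏ j, p (s j) = 1 := by
      rw [← Fintype.sum_pow, hp1, one_pow]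
    have hone : (K • (1 : Matrix ι ι ℝ)).PosDef := PosDef.one.smul hK
    calc _ = ∑ s : Fin q → α, (∏ j, p (s j)) * ∑ x, p x *
            ((K • (1 : Matrix ι ι ℝ) + ∑ j, vecMulVec (g (s j)) (g (s j)) +
              vecMulVec (g x) (g x))⁻¹ ^ 2 ^ k).trace := by
          rw [← (Fin.consEquiv fun _ : Fin (q + 1) => α).sum_comp, Fintype.sum_prod_type_right]
          refine Finset.sum_congr rfl fun s _ => ?_
          rw [Finset.mul_sum]
          refine Finset.sum_congr rfl fun x _ => ?_
          simp only [Fin.consEquiv_apply, Fin.prod_univ_succ, Fin.sum_univ_succ, Fin.cons_zero,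
            Fin.cons_succ]
          rw [add_comm (vecMulVec (g x) (g x)), ← add_assoc]
          ring
      _ ≤ ∑ s : Fin q → α, (∏ j, p (s j)) * ((1 - (1 - η) * (2 ^ k + 1) * y) *
            ((K • (1 : Matrix ι ι ℝ) + ∑ j, vecMulVec (g (s j)) (g (s j)))⁻¹ ^ 2 ^ k).trace +
            (1 - η) * (Fintype.card ι * y ^ (2 ^ k + 1))) := by
          refine Finset.sum_le_sum fun s _ => mul_le_mul_of_nonneg_left ?_
            (Finset.prod_nonneg fun j _ => hp _)
          have hY : (∑ j, vecMulVec (g (s j)) (g (s j))).PosSemidef :=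
            posSemidef_sum _ fun j _ => posSemidef_vecMulVec_self _
          refine sum_mul_trace_inv_pow_le hp hp1 hiso hg hK hη hη1 (hone.add_posSemidef hY) ?_ hy0
          intro v
          have := hY.dotProduct_mulVec_nonneg v
          rw [add_mulVec, dotProduct_add, smul_mulVec, one_mulVec, dotProduct_smul, smul_eq_mul]
          simpa using this
      _ = (1 - (1 - η) * (2 ^ k + 1) * y) * (∑ s : Fin q → α, (∏ j, p (s j)) *
            ((K • (1 : Matrix ι ι ℝ) + ∑ j, vecMulVec (g (s j)) (g (s j)))⁻¹ ^ 2 ^ k).trace) +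
            (1 - η) * (Fintype.card ι * y ^ (2 ^ k + 1)) := by
          simp_rw [mul_add, Finset.sum_add_distrib]
          rw [← Finset.sum_mul, hprod, one_mul, Finset.mul_sum]
          congr 1
          exact Finset.sum_congr rfl fun s _ => by ring
      _ ≤ (1 - (1 - η) * (2 ^ k + 1) * y) * (Fintype.card ι * y ^ 2 ^ k) +
            (1 - η) * (Fintype.card ι * y ^ (2 ^ k + 1)) := by gcongr
      _ = Fintype.card ι * (y ^ 2 ^ k * (1 - 2 ^ k * ((1 - η) * y))) := by ring
      _ ≤ _ := by
          refine mul_le_mul_of_nonneg_left ?_ (Nat.cast_nonneg _)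
          have hz : 0 ≤ (1 - η) * y := by positivity
          have h := one_sub_nat_mul_mul_one_add_pow_le_one hz (2 ^ k)
          have e : K + (1 - η) * ((q + 1 : ℕ) : ℝ) = b * (1 + (1 - η) * y) := by
            push_cast
            linear_combination -(1 - η) * hby + hb.symm
          rw [e, mul_inv, mul_pow, ← hy, inv_pow (1 + _)]
          gcongr
          rw [← one_div, le_div_iff₀ (by positivity)]
          exact_mod_cast h

/-- Markov's inequality for finite sums. -/
theorem mul_sum_filter_le_sum_mul {β : Type*} [Fintype β] {W f : β → ℝ} (hW : ∀ s, 0 ≤ W s)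
    (hf : ∀ s, 0 ≤ f s) {a : ℝ} {B : β → Prop} [DecidablePred B] (hB : ∀ s, B s → a ≤ f s) :
    a * ∑ s with B s, W s ≤ ∑ s, W s * f s := by
  rw [Finset.mul_sum]
  refine le_trans (Finset.sum_le_sum fun s hs => ?_)
    (Finset.sum_le_univ_sum_of_nonneg fun s => mul_nonneg (hW s) (hf s))
  rw [mul_comm]
  exact mul_le_mul_of_nonneg_left (hB s (Finset.mem_filter.mp hs).2) (hW s)

theorem exists_two_pow_mem_Icc {L : ℝ} (hL : 1 ≤ L) :
    ∃ k : ℕ, L ≤ 2 ^ k ∧ (2 : ℝ) ^ k ≤ 2 * L := by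
  obtain ⟨k, h1, h2⟩ := exists_nat_pow_near hL (one_lt_two (α := ℝ))
  exact ⟨k + 1, h2.le, by rw [pow_succ]; linarith⟩

open Classical in
/-- Lower tail of a sum of `q` independent copies of `g gᵀ` with `E g gᵀ = 1`: it dominates
`(1 - ε) q` with probability at least `1 / 2`. -/
theorem sum_filter_not_lower_bound_le (hp : ∀ x, 0 ≤ p x) (hp1 : ∑ x, p x = 1)
    (hiso : ∑ x, p x • vecMulVec (g x) (g x) = 1)
    (hg : ∀ x, g x ⬝ᵥ g x ≤ Fintype.card ι) (hn : 2 ≤ Fintype.card ι) {ε : ℝ} (hε : 0 < ε)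
    (hε1 : ε < 1) {q : ℕ}
    (hq : 128 * (Fintype.card ι * Real.log (Fintype.card ι) / ε ^ 2) ≤ q) :
    ∑ s : Fin q → α with ¬ ∀ v, (1 - ε) * q * (v ⬝ᵥ v) ≤
        v ⬝ᵥ (∑ j, vecMulVec (g (s j)) (g (s j))) *ᵥ v, ∏ j, p (s j) ≤ 1 / 2 := by
  set n : ℝ := (Fintype.card ι : ℝ) with hndef
  have hn2 : (2 : ℝ) ≤ n := by rw [hndef]; exact_mod_cast hn
  have hlog2 : 1 / 2 ≤ Real.log 2 := by linarith [Real.log_two_gt_d9]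
  have hlog : Real.log 2 ≤ Real.log n := Real.log_le_log two_pos hn2
  have hL1 : 1 ≤ 8 * Real.log n / ε := by
    rw [le_div_iff₀ hε]; linarith
  -- The exponent `m = 2 ^ k ≥ 8 log n / ε` makes `(2 n) ^ (-1 / m) ≥ 1 - ε / 4`; the starting value `K` is
  -- the least one for which `η = ε / 4` is admissible.
  obtain ⟨k, hk1, hk2⟩ := exists_two_pow_mem_Icc hL1
  set M : ℝ := 2 ^ k with hM
  have hM1 : 1 ≤ M := hL1.trans hk1
  set K : ℝ := 4 * (M + 1) * n / ε with hKdef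
  have hK : 0 < K := by positivity
  have hKM : M + 1 ≤ K := by
    rw [hKdef, le_div_iff₀ hε]
    nlinarith
  have hη : (M + 1) * (n / K) ≤ ε / 4 := by
    rw [hKdef]; apply le_of_eq; field_simp
  have hKq : K ≤ q := by
    refine le_trans ?_ hq
    have h1 : K ≤ 8 * M * n / ε := by
      rw [hKdef]; gcongr ?_ * _ / _; linarith
    have h2 : 8 * M * n / ε ≤ 8 * (2 * (8 * Real.log n / ε)) * n / ε := by gcongr
    refine (h1.trans h2).trans (le_of_eq ?_)
    field_simp
    ring
  have hpot := sum_prod_mul_trace_inv_pow_le hp hp1 hiso hg hK hη (by positivity) (by linarith) hKM q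
  rw [← hndef] at hpot
  set b : ℝ := K + (1 - ε / 4) * q with hb
  have hb0 : 0 < b := by
    have : 0 ≤ (1 - ε / 4) * q := mul_nonneg (by linarith) (Nat.cast_nonneg _)
    linarith
  -- Twice the bound for the expected potential, so that Markov's inequality gives `1 / 2`.
  set a : ℝ := 2 * n * b⁻¹ ^ 2 ^ k with ha
  have ha0 : 0 < a := by positivity
  have hone : (K • (1 : Matrix ι ι ℝ)).PosDef := PosDef.one.smul hK
  have hY : ∀ s : Fin q → α, (∑ j, vecMulVec (g (s j)) (g (s j))).PosSemidef := fun s =>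
    posSemidef_sum _ fun j _ => posSemidef_vecMulVec_self _
  have hmarkov := mul_sum_filter_le_sum_mul (β := Fin q → α) (W := fun s => ∏ j, p (s j))
    (f := fun s =>
      ((K • (1 : Matrix ι ι ℝ) + ∑ j, vecMulVec (g (s j)) (g (s j)))⁻¹ ^ 2 ^ k).trace)
    (a := a) (B := fun s => ¬ ∀ v, (1 - ε) * q * (v ⬝ᵥ v) ≤
        v ⬝ᵥ (∑ j, vecMulVec (g (s j)) (g (s j))) *ᵥ v)
    (fun s => Finset.prod_nonneg fun j _ => hp _)
    (fun s => ((hone.add_posSemidef (hY s)).inv.posSemidef.pow _).trace_nonneg) ?_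
  · have h := hmarkov.trans hpot
    rw [ha] at h
    have hc : 0 < n * b⁻¹ ^ 2 ^ k := by positivity
    refine not_lt.mp fun hcon => ?_
    nlinarith [mul_lt_mul_of_pos_left hcon hc]
  · intro s
    contrapose!
    intro hlt v
    have hδ : 0 < 1 - ε / 4 := by linarith
    have hρ : 0 < ((1 - ε / 4) * b)⁻¹ := by positivity
    have hpow : (1 - ε / 4) ^ 2 ^ k * (2 * n) ≤ 1 := by
      have h1 : (1 - ε / 4) ^ 2 ^ k ≤ Real.exp (-(ε / 4)) ^ 2 ^ k := by
        gcongr; linarith [Real.add_one_le_exp (-(ε / 4))]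
      have h2 : Real.log (2 * n) ≤ M * (ε / 4) := by
        rw [Real.log_mul two_ne_zero (by positivity)]
        rw [div_le_iff₀ hε] at hk1
        linarith
      have h3 : 2 * n ≤ Real.exp (M * (ε / 4)) := (Real.log_le_iff_le_exp (by positivity)).mp h2
      calc (1 - ε / 4) ^ 2 ^ k * (2 * n)
          ≤ Real.exp (-(ε / 4)) ^ 2 ^ k * Real.exp (M * (ε / 4)) := by gcongr
        _ = 1 := by
          rw [← Real.exp_nat_mul, ← Real.exp_add, hM]
          push_cast
          rw [mul_neg, neg_add_cancel, Real.exp_zero]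
    have htr : a ≤ ((1 - ε / 4) * b)⁻¹ ^ 2 ^ k := by
      rw [mul_inv, mul_pow, ha, inv_pow (1 - ε / 4)]
      gcongr
      rw [← one_div, le_div_iff₀ (by positivity), mul_comm]
      exact hpow
    have h := le_mul_dotProduct_mulVec_of_trace_inv_pow_le (hone.add_posSemidef (hY s))
      (pow_ne_zero k two_ne_zero) hρ (hlt.le.trans htr) v
    rw [add_mulVec, dotProduct_add, smul_mulVec, one_mulVec, dotProduct_smul, smul_eq_mul,
      inv_mul_eq_div, le_div_iff₀ (by positivity)] at h
    have hv : 0 ≤ v ⬝ᵥ v := Finset.sum_nonneg fun i _ => mul_self_nonneg _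
    have hnum : (1 - ε) * q + K ≤ (1 - ε / 4) * b := by
      rw [hb]
      nlinarith [mul_nonneg hε.le (sub_nonneg.mpr hKq), mul_nonneg (mul_nonneg hε.le hε.le) (Nat.cast_nonneg (α := ℝ) q)]
    nlinarith [mul_le_mul_of_nonneg_right hnum hv]

end Concentration

/-! ### Leverage score sampling -/

section Leverage

open Matrix

theorem trace_inv_mul_vecMulVec_nonneg {ι : Type*} [Fintype ι] [DecidableEq ι] {A : Matrix ι ι ℝ}
    (hA : A.PosDef) (v : ι → ℝ) : 0 ≤ (A⁻¹ * vecMulVec v v).trace := by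
  rw [trace_mul_comm, trace_vecMulVec_mul]
  exact hA.inv.posSemidef.dotProduct_mulVec_nonneg v

open Classical in
/-- Sampling the summands of `A = ∑ x, h x (h x)ᵀ` with probabilities proportional to their leverage
scores, and weighting them by the inverse probabilities, gives a matrix that dominates `(1 - ε) q A`
with probability at least `1 / 2`. -/
theorem sum_filter_not_leverage_lower_bound_le {ι α : Type*} [Fintype ι] [DecidableEq ι] [Fintype α]
    {A : Matrix ι ι ℝ} (hA : A.PosDef) {h : α → ι → ℝ} (hsum : ∑ x, vecMulVec (h x) (h x) = A)
    {p : α → ℝ} (hp : ∀ x, p x = (A⁻¹ * vecMulVec (h x) (h x)).trace / Fintype.card ι)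
    (hn : 2 ≤ Fintype.card ι) {ε : ℝ} (hε : 0 < ε) (hε1 : ε < 1) {q : ℕ}
    (hq : 128 * (Fintype.card ι * Real.log (Fintype.card ι) / ε ^ 2) ≤ q) :
    ∑ s : Fin q → α with ¬ ∀ v, (1 - ε) * q * (v ⬝ᵥ A *ᵥ v) ≤
        ∑ j, (p (s j))⁻¹ * (h (s j) ⬝ᵥ v) ^ 2, ∏ j, p (s j) ≤ 1 / 2 := by
  have hn0 : (0 : ℝ) < Fintype.card ι := by exact_mod_cast (by omega : 0 < Fintype.card ι)
  obtain ⟨R, hR⟩ := exists_eq_transpose_mul_self hA.posSemidef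
  have hRdet : IsUnit R.det := by
    have : IsUnit A.det := hA.isUnit.map detMonoidHom
    rw [hR, det_mul] at this
    exact isUnit_of_mul_isUnit_right this
  have hRR : R⁻¹ * R = 1 := nonsing_inv_mul _ hRdet
  have hRR' : R * R⁻¹ = 1 := mul_nonsing_inv _ hRdet
  have hRt : R⁻¹ᵀ * Rᵀ = 1 := by rw [← transpose_mul, hRR', transpose_one]
  set u : α → ι → ℝ := fun x => R⁻¹ᵀ *ᵥ h x with hu
  have huu : ∀ x, u x ⬝ᵥ u x = Fintype.card ι * p x := fun x => by
    rw [hp, mul_div_cancel₀ _ hn0.ne', trace_mul_comm, trace_vecMulVec_mul, hR, Matrix.mul_inv_rev,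
      ← transpose_nonsing_inv, ← mulVec_mulVec, dotProduct_mulVec, ← mulVec_transpose,
      transpose_transpose, dotProduct_comm]
  have hp0 : ∀ x, 0 ≤ p x := fun x => by
    rw [hp]; exact div_nonneg (trace_inv_mul_vecMulVec_nonneg hA _) hn0.le
  have husum : ∑ x, vecMulVec (u x) (u x) = 1 := by
    have h1 : ∀ x, vecMulVec (u x) (u x) = R⁻¹ᵀ * vecMulVec (h x) (h x) * R⁻¹ := fun x => by
      rw [mul_vecMulVec, vecMulVec_mul, ← mulVec_transpose]
    rw [Finset.sum_congr rfl fun x _ => h1 x, ← Finset.sum_mul, ← Finset.mul_sum, hsum, hR,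
      ← mul_assoc, hRt, one_mul, hRR']
  have hp1 : ∑ x, p x = 1 := by
    have h1 := congrArg trace husum
    simp only [trace_sum, trace_vecMulVec, huu, trace_one, ← Finset.mul_sum] at h1
    exact mul_left_cancel₀ hn0.ne' (h1.trans (mul_one _).symm)
  set g : α → ι → ℝ := fun x => (√(p x))⁻¹ • u x with hg
  have hvec : ∀ x, vecMulVec (g x) (g x) = (p x)⁻¹ • vecMulVec (u x) (u x) := fun x => by
    simp only [hg, smul_vecMulVec, vecMulVec_smul, smul_smul]
    rw [← mul_inv, Real.mul_self_sqrt (hp0 x)]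
  have hiso : ∑ x, p x • vecMulVec (g x) (g x) = 1 := by
    rw [← husum]
    refine Finset.sum_congr rfl fun x _ => ?_
    rw [hvec, smul_smul]
    -- If `p x = 0`, then `g x = 0` by the convention `0⁻¹ = 0`, and `u x = 0` as well.
    by_cases hx : p x = 0
    · have h0 : u x = 0 := by
        rw [← dotProduct_self_eq_zero, huu, hx, mul_zero]
      simp [h0]
    · rw [mul_inv_cancel₀ hx, one_smul]
  have hgg : ∀ x, g x ⬝ᵥ g x ≤ Fintype.card ι := fun x => by
    rw [← trace_vecMulVec, hvec, trace_smul, trace_vecMulVec, huu, smul_eq_mul]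
    by_cases hx : p x = 0
    · simp [hx]
    · rw [mul_left_comm, inv_mul_cancel₀ hx, mul_one]
  refine le_trans (Finset.sum_le_sum_of_subset_of_nonneg ?_ fun s _ _ =>
    Finset.prod_nonneg fun j _ => hp0 _)
    (sum_filter_not_lower_bound_le hp0 hp1 hiso hgg hn hε hε1 hq)
  intro s
  simp only [Finset.mem_filter, Finset.mem_univ, true_and]
  contrapose!
  intro hs v
  have h1 := hs (R *ᵥ v)
  have h2 : (R *ᵥ v) ⬝ᵥ (R *ᵥ v) = v ⬝ᵥ A *ᵥ v := by
    rw [hR, ← mulVec_mulVec, dotProduct_mulVec v, vecMul_transpose]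
  have h3 : ∀ x, (R *ᵥ v) ⬝ᵥ vecMulVec (g x) (g x) *ᵥ (R *ᵥ v) = (p x)⁻¹ * (h x ⬝ᵥ v) ^ 2 :=
    fun x => by
      rw [hvec, smul_mulVec, dotProduct_smul, dotProduct_vecMulVec_mulVec, smul_eq_mul, hu]
      rw [dotProduct_mulVec, ← mulVec_transpose, mulVec_mulVec, ← transpose_mul, hRR, transpose_one,
        one_mulVec]
  rw [h2, sum_mulVec, dotProduct_sum, Finset.sum_congr rfl fun j _ => h3 (s j)] at h1
  exact h1

end Leverage

/-! ### The feature model -/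

section FeatureModel

open Matrix

variable {Θ : Type*} {n : ℕ}

/-- Up to `σ⁻²`, the matrix is `MᵀM` where `M` is the projection of `F` to the orthogonal complement of
the column space of `E`. -/
theorem featureInfo_posSemidef {m : ℕ} (σ : ℝ) (F : Matrix (Fin m) (Fin n) ℝ)
    (E : Matrix (Fin m) (Fin 3) ℝ) (hE : IsUnit (Eᵀ * E).det) :
    (featureInfo σ F E).PosSemidef := by
  set G := (Eᵀ * E)⁻¹ with hG
  have hGt : Gᵀ = G := by rw [hG, transpose_nonsing_inv, transpose_mul, transpose_transpose]
  have h1 : G * (Eᵀ * E) = 1 := nonsing_inv_mul _ hE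
  have key : Fᵀ * F - Fᵀ * E * G * Eᵀ * F = (F - E * G * Eᵀ * F)ᵀ * (F - E * G * Eᵀ * F) := by
    have h2 : Fᵀ * E * G * Eᵀ * (E * G * Eᵀ * F) = Fᵀ * E * G * Eᵀ * F := by
      calc _ = Fᵀ * E * (G * (Eᵀ * E)) * G * Eᵀ * F := by simp only [Matrix.mul_assoc]
        _ = _ := by rw [h1, Matrix.mul_one]
    have h3 : (F - E * G * Eᵀ * F)ᵀ = Fᵀ - Fᵀ * E * G * Eᵀ := by
      simp only [transpose_sub, transpose_mul, transpose_transpose, hGt, Matrix.mul_assoc]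
    rw [h3, Matrix.sub_mul, Matrix.mul_sub, Matrix.mul_sub, h2, sub_self, sub_zero]
    simp only [Matrix.mul_assoc]
  rw [featureInfo, key]
  exact (posSemidef_conjTranspose_mul_self (F - E * G * Eᵀ * F)).smul (by positivity)

theorem mem_select [DecidableEq Θ] {q : ℕ} (H₀ : Matrix (Fin n) (Fin n) ℝ)
    (H : Θ → Matrix (Fin n) (Fin n) ℝ) (s : Fin q → Θ) (k : Fin q) : s k ∈ (select H₀ H s).1 := by
  have key : ∀ (l : List Θ) (st : Finset Θ × Matrix (Fin n) (Fin n) ℝ) (f : Θ),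
      f ∈ l ∨ f ∈ st.1 → f ∈ (l.foldl (selectStep H) st).1 := by
    intro l
    induction l with
    | nil => intro st f hf; simpa using hf
    | cons a l ih =>
      intro st f hf
      rw [List.foldl_cons]
      refine ih _ _ ?_
      rw [List.mem_cons] at hf
      unfold selectStep
      split_ifs with ha
      · rcases hf with (rfl | hf) | hf
        · exact Or.inr ha
        · exact Or.inl hf
        · exact Or.inr hf
      · rcases hf with (rfl | hf) | hf
        · exact Or.inr (Finset.mem_insert_self _ _)
        · exact Or.inl hf
        · exact Or.inr (Finset.mem_insert_of_mem hf)
  exact key _ _ _ (Or.inl (List.mem_ofFn.mpr ⟨k, rfl⟩))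

variable {H₀ : Matrix (Fin n) (Fin n) ℝ} {H : Θ → Matrix (Fin n) (Fin n) ℝ}

theorem infoMatrix_posDef (hH₀ : H₀.PosDef) (hH : ∀ f, (H f).PosSemidef) (Φ : Finset Θ) :
    (infoMatrix H₀ H Φ).PosDef :=
  hH₀.add_posSemidef (posSemidef_sum _ fun f _ => hH f)

variable [Fintype Θ] {h : Θ → Fin n → Fin n → ℝ}

theorem sum_vecMulVec_eq_infoMatrix [Nonempty Θ] (hh : IsOrthogonalDecomposition H₀ H h) :
    ∑ x : Θ × Fin n, vecMulVec (h x.1 x.2) (h x.1 x.2) = infoMatrix H₀ H Finset.univ := by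
  have hN : (Fintype.card Θ : ℝ) ≠ 0 := by exact_mod_cast Fintype.card_ne_zero
  rw [Fintype.sum_prod_type]
  simp only [← (hh _).2, barInfo, infoMatrix, Finset.sum_add_distrib, Finset.sum_const,
    Finset.card_univ]
  rw [← Nat.cast_smul_eq_nsmul ℝ, smul_smul, mul_one_div_cancel hN, one_smul]

theorem sum_refinedProb (hh : IsOrthogonalDecomposition H₀ H h) (f : Θ) :
    ∑ i, refinedProb H₀ H h f i = sampleProb H₀ H f := by
  simp only [refinedProb, refinedLeverage, sampleProb, leverage, ← Finset.sum_div]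
  rw [(hh f).2, Finset.mul_sum, trace_sum]

theorem refinedProb_nonneg (hA : (infoMatrix H₀ H Finset.univ).PosDef) (f : Θ) (i : Fin n) :
    0 ≤ refinedProb H₀ H h f i :=
  div_nonneg (trace_inv_mul_vecMulVec_nonneg hA _) (Nat.cast_nonneg _)

/-- The two-stage draw of a pair is a draw from `refinedProb`. If `sampleProb` vanishes at `f`, the junk
value of the quotient in `indexProb` does not matter. -/
theorem sampleProb_mul_indexProb (hA : (infoMatrix H₀ H Finset.univ).PosDef)
    (hh : IsOrthogonalDecomposition H₀ H h) (f : Θ) (i : Fin n) :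
    sampleProb H₀ H f * indexProb H₀ H h f i = refinedProb H₀ H h f i := by
  rw [indexProb, sum_refinedProb hh]
  by_cases h0 : sampleProb H₀ H f = 0
  · have h1 := (Finset.sum_eq_zero_iff_of_nonneg fun j _ => refinedProb_nonneg (h := h) hA f j).mp
      ((sum_refinedProb hh f).trans h0) i (Finset.mem_univ i)
    rw [h0, h1, zero_mul]
  · exact mul_div_cancel₀ _ h0

/-- The prior enters through `(1 / N) H₀` for each feature of `Φ`, so at most once in total. -/
theorem sum_vecMulVec_quadratic_le (hH₀ : H₀.PosDef)
    (hh : IsOrthogonalDecomposition H₀ H h) {T : Finset (Θ × Fin n)} {Φ : Finset Θ}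
    (hT : ∀ x ∈ T, x.1 ∈ Φ) (v : Fin n → ℝ) :
    ∑ x ∈ T, (h x.1 x.2 ⬝ᵥ v) ^ 2 ≤ v ⬝ᵥ infoMatrix H₀ H Φ *ᵥ v := by
  have h0 : 0 ≤ v ⬝ᵥ H₀ *ᵥ v := hH₀.posSemidef.dotProduct_mulVec_nonneg v
  calc ∑ x ∈ T, (h x.1 x.2 ⬝ᵥ v) ^ 2 ≤ ∑ x ∈ Φ ×ˢ Finset.univ, (h x.1 x.2 ⬝ᵥ v) ^ 2 :=
        Finset.sum_le_sum_of_subset_of_nonneg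
          (fun x hx => Finset.mem_product.mpr ⟨hT x hx, Finset.mem_univ _⟩)
          fun x _ _ => sq_nonneg _
    _ = ∑ f ∈ Φ, v ⬝ᵥ barInfo H₀ H f *ᵥ v := by
        rw [Finset.sum_product]
        refine Finset.sum_congr rfl fun f _ => ?_
        rw [(hh f).2, sum_mulVec, dotProduct_sum]
        simp only [dotProduct_vecMulVec_mulVec]
    _ = (Φ.card / Fintype.card Θ : ℝ) * (v ⬝ᵥ H₀ *ᵥ v) + ∑ f ∈ Φ, v ⬝ᵥ H f *ᵥ v := by
        simp only [barInfo, add_mulVec, dotProduct_add, smul_mulVec, dotProduct_smul, smul_eq_mul,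
          Finset.sum_add_distrib, Finset.sum_const, nsmul_eq_mul]
        ring
    _ ≤ 1 * (v ⬝ᵥ H₀ *ᵥ v) + ∑ f ∈ Φ, v ⬝ᵥ H f *ᵥ v := by
        gcongr
        exact div_le_one_of_le₀ (by exact_mod_cast Finset.card_le_univ Φ) (Nat.cast_nonneg _)
    _ = _ := by
        rw [infoMatrix, add_mulVec, dotProduct_add, sum_mulVec, dotProduct_sum, one_mul]

/-! ### The weight spread -/

section Spread

variable [DecidableEq Θ] {q : ℕ}

theorem weight_nonneg (hA : (infoMatrix H₀ H Finset.univ).PosDef) (s : Fin q → Θ × Fin n)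
    (x : Θ × Fin n) : 0 ≤ weight H₀ H h s x :=
  mul_nonneg (Nat.cast_nonneg _) (inv_nonneg.mpr
    (mul_nonneg (Nat.cast_nonneg _) (refinedProb_nonneg hA _ _)))

theorem chi_nonneg (s : Fin q → Θ × Fin n) : 0 ≤ chi H₀ H h s :=
  Real.sInf_nonneg fun _ hγ => hγ.1.le

/-- The infimum in the definition of `chi` is attained, up to the condition `0 < γ`. -/
theorem sum_weight_sq_le_chi_mul (hA : (infoMatrix H₀ H Finset.univ).PosDef)
    (s : Fin q → Θ × Fin n) (v : Fin n → ℝ) :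
    ∑ x ∈ Finset.univ.image s, weight H₀ H h s x ^ 2 * (h x.1 x.2 ⬝ᵥ v) ^ 2 ≤
      chi H₀ H h s * ∑ x ∈ Finset.univ.image s, weight H₀ H h s x * (h x.1 x.2 ⬝ᵥ v) ^ 2 := by
  set w := weight H₀ H h s with hw
  have hw0 : ∀ x, 0 ≤ w x := weight_nonneg hA s
  set a := ∑ x ∈ Finset.univ.image s, w x * (h x.1 x.2 ⬝ᵥ v) ^ 2 with ha
  set b := ∑ x ∈ Finset.univ.image s, w x ^ 2 * (h x.1 x.2 ⬝ᵥ v) ^ 2 with hb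
  have ha0 : 0 ≤ a := Finset.sum_nonneg fun x _ => mul_nonneg (hw0 x) (sq_nonneg _)
  set S := {γ : ℝ | 0 < γ ∧
    (∑ x ∈ Finset.univ.image s, (w x * (γ - w x)) •
      vecMulVec (h x.1 x.2) (h x.1 x.2)).PosSemidef} with hS
  have hne : S.Nonempty := by
    refine ⟨1 + ∑ x, w x, add_pos_of_pos_of_nonneg one_pos (Finset.sum_nonneg fun x _ => hw0 x),
      posSemidef_sum _ fun x _ => (posSemidef_vecMulVec_self _).smul (mul_nonneg (hw0 x) ?_)⟩
    have := Finset.single_le_sum (f := w) (fun y _ => hw0 y) (Finset.mem_univ x)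
    linarith
  have hmem : ∀ γ ∈ S, b ≤ γ * a := fun γ hγ => by
    have h1 := hγ.2.dotProduct_mulVec_nonneg v
    rw [star_trivial, sum_mulVec, dotProduct_sum] at h1
    simp only [smul_mulVec, dotProduct_smul, dotProduct_vecMulVec_mulVec, smul_eq_mul] at h1
    rw [← sub_nonneg, ha, hb, Finset.mul_sum, ← Finset.sum_sub_distrib]
    refine h1.trans_eq (Finset.sum_congr rfl fun x _ => by ring)
  rcases ha0.eq_or_lt with h0 | h0
  · obtain ⟨γ, hγ⟩ := hne
    have := hmem γ hγ
    rw [← h0, mul_zero] at this ⊢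
    exact this
  · rw [← div_le_iff₀ h0]
    exact le_csInf hne fun γ hγ => (div_le_iff₀ h0).mpr (hmem γ hγ)

/-- Removing the weights costs at most the factor `chi`: Cauchy–Schwarz bounds `(∑ w a²)²` by
`(∑ w² a²) (∑ a²)`, and `∑ w² a² ≤ chi * ∑ w a²`. -/
theorem sum_weight_mul_le_chi_mul (hA : (infoMatrix H₀ H Finset.univ).PosDef)
    (s : Fin q → Θ × Fin n) (v : Fin n → ℝ) :
    ∑ x ∈ Finset.univ.image s, weight H₀ H h s x * (h x.1 x.2 ⬝ᵥ v) ^ 2 ≤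
      chi H₀ H h s * ∑ x ∈ Finset.univ.image s, (h x.1 x.2 ⬝ᵥ v) ^ 2 := by
  have h1 := sum_weight_sq_le_chi_mul (h := h) hA s v
  have h2 := Finset.sum_mul_sq_le_sq_mul_sq (Finset.univ.image s)
    (fun x => weight H₀ H h s x * (h x.1 x.2 ⬝ᵥ v)) fun x => h x.1 x.2 ⬝ᵥ v
  simp only [mul_pow, mul_assoc, ← pow_two] at h2
  set a := ∑ x ∈ Finset.univ.image s, weight H₀ H h s x * (h x.1 x.2 ⬝ᵥ v) ^ 2 with ha
  set d := ∑ x ∈ Finset.univ.image s, (h x.1 x.2 ⬝ᵥ v) ^ 2 with hd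
  have ha0 : 0 ≤ a := Finset.sum_nonneg fun x _ => mul_nonneg (weight_nonneg hA s x) (sq_nonneg _)
  have hd0 : 0 ≤ d := Finset.sum_nonneg fun x _ => sq_nonneg _
  rcases ha0.eq_or_lt with h0 | h0
  · rw [← h0]
    exact mul_nonneg (chi_nonneg s) hd0
  · refine le_of_mul_le_mul_left ?_ h0
    nlinarith [mul_le_mul_of_nonneg_right h1 hd0]

/-- The weighted sum over the set of drawn pairs, as a sum over the draws. -/
theorem sum_weight_mul_eq (s : Fin q → Θ × Fin n) (v : Fin n → ℝ) :
    q * ∑ x ∈ Finset.univ.image s, weight H₀ H h s x * (h x.1 x.2 ⬝ᵥ v) ^ 2 =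
      ∑ k, (refinedProb H₀ H h (s k).1 (s k).2)⁻¹ * (h (s k).1 (s k).2 ⬝ᵥ v) ^ 2 := by
  rcases Nat.eq_zero_or_pos q with rfl | hq
  · simp
  have hq0 : (q : ℝ) ≠ 0 := by exact_mod_cast hq.ne'
  rw [Finset.sum_comp (fun x : Θ × Fin n =>
    (refinedProb H₀ H h x.1 x.2)⁻¹ * (h x.1 x.2 ⬝ᵥ v) ^ 2) s, Finset.mul_sum]
  refine Finset.sum_congr rfl fun x _ => ?_
  rw [weight, nsmul_eq_mul, mul_inv]
  field_simp

theorem chi_pos (hA : (infoMatrix H₀ H Finset.univ).PosDef) (hq : 0 < q) {s : Fin q → Θ × Fin n}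
    (hs : ∀ k, 0 < refinedProb H₀ H h (s k).1 (s k).2) : 0 < chi H₀ H h s := by
  set x := s ⟨0, hq⟩ with hx
  have hpx := hs ⟨0, hq⟩
  rw [← hx] at hpx
  have hxmem : x ∈ Finset.univ.image s := Finset.mem_image_of_mem s (Finset.mem_univ _)
  have hw : 0 < weight H₀ H h s x := by
    refine mul_pos ?_ (inv_pos.mpr (mul_pos (by exact_mod_cast hq) hpx))
    have : (⟨0, hq⟩ : Fin q) ∈ Finset.univ.filter fun k => s k = x :=
      Finset.mem_filter.mpr ⟨Finset.mem_univ _, hx.symm⟩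
    exact_mod_cast Finset.card_pos.mpr ⟨_, this⟩
  have hh0 : h x.1 x.2 ⬝ᵥ h x.1 x.2 ≠ 0 := fun h0 => by
    rw [dotProduct_self_eq_zero] at h0
    simp [refinedProb, refinedLeverage, h0] at hpx
  have hb : 0 < ∑ y ∈ Finset.univ.image s,
      weight H₀ H h s y ^ 2 * (h y.1 y.2 ⬝ᵥ h x.1 x.2) ^ 2 :=
    Finset.sum_pos' (fun y _ => by positivity) ⟨x, hxmem, by positivity⟩
  have h1 := hb.trans_le (sum_weight_sq_le_chi_mul hA s (h x.1 x.2))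
  exact (pos_iff_pos_of_mul_pos h1).mpr
    ((Finset.sum_nonneg fun y _ => mul_nonneg (weight_nonneg hA s y) (sq_nonneg _)).lt_of_ne'
      fun h0 => by rw [h0, mul_zero] at h1; exact h1.false)

end Spread

end FeatureModel

/-! ### Independent sampling -/

section Sampling

open Classical in
theorem sum_filter_prod_le_measureReal {Θ Ω : Type*} [Fintype Θ] [MeasurableSpace Θ]
    [MeasurableSingletonClass Θ] [MeasurableSpace Ω] {P : Measure Ω} [IsProbabilityMeasure P]
    {q : ℕ} {X : Fin q → Ω → Θ} (hX : ∀ k, Measurable (X k)) (hind : iIndepFun X P)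
    (B : (Fin q → Θ) → Prop) :
    ∑ s with B s, ∏ k, P.real {ω | X k ω = s k} ≤ P.real {ω | B fun k => X k ω} := by
  have hset : {ω | B fun k => X k ω} =
      ⋃ s ∈ Finset.univ.filter B, ⋂ k ∈ Finset.univ, X k ⁻¹' {s k} := by
    ext ω
    simp only [Set.mem_ofPred_eq, Finset.mem_filter, Finset.mem_univ, true_and, Set.mem_iUnion,
      Set.mem_iInter, Set.mem_preimage, Set.mem_singleton_iff, exists_prop, forall_const]
    exact ⟨fun hB => ⟨_, hB, fun k => rfl⟩, fun ⟨s, hB, hs⟩ => by rwa [funext hs]⟩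
  rw [hset, measureReal_biUnion_finset]
  · refine le_of_eq (Finset.sum_congr rfl fun s _ => ?_)
    rw [measureReal_def, hind.measure_inter_preimage_eq_mul Finset.univ (sets := fun k => {s k})
      (fun k _ => measurableSet_singleton _), ENNReal.toReal_prod]
    rfl
  · intro s _ s' _ hne
    rw [Function.onFun, Set.disjoint_left]
    intro ω hω hω'
    simp only [Finset.mem_univ, Set.iInter_true, Set.mem_iInter, Set.mem_preimage,
      Set.mem_singleton_iff] at hω hω'
    exact hne (funext fun k => (hω k).symm.trans (hω' k))
  · exact fun s _ => Finset.measurableSet_biInter _ fun k _ => hX k (measurableSet_singleton _)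

/-- The first components of independent pairs are independent draws from the marginal distribution. -/
theorem sum_filter_fst_prod {Θ κ : Type*} [Fintype Θ] [Fintype κ] {q : ℕ} (p : Θ × κ → ℝ)
    (B : (Fin q → Θ) → Prop) [DecidablePred B] :
    ∑ s : Fin q → Θ × κ with B (fun k => (s k).1), ∏ k, p (s k) =
      ∑ s with B s, ∏ k, ∑ i, p (s k, i) := by
  classical
  simp only [Finset.sum_filter, Finset.prod_univ_sum, Fintype.piFinset_univ]
  rw [← (Equiv.arrowProdEquivProdArrow (Fin q) (fun _ => Θ) (fun _ => κ)).symm.sum_comp,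
    Fintype.sum_prod_type]
  refine Finset.sum_congr rfl fun s _ => ?_
  by_cases hs : B s <;> simp [hs, Equiv.arrowProdEquivProdArrow]

end Sampling

end FeatureSelection

/-! ### Lower bound for the selected information -/

open FeatureSelection
theorem theorem1 :
    ∃ C : ℝ, 0 < C ∧
      ∀ (n : ℕ) (_ : 2 ≤ n)
        -- the available features
        (Θ : Type*) [Fintype Θ] [DecidableEq Θ] [MeasurableSpace Θ] [MeasurableSingletonClass Θ]
        -- the prior information matrix and the observation models of the features
        (H₀ : Matrix (Fin n) (Fin n) ℝ) (_ : H₀.PosDef)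
        (σ : ℝ) (_ : 0 < σ) (m : Θ → ℕ)
        (F : ∀ f, Matrix (Fin (m f)) (Fin n) ℝ) (E : ∀ f, Matrix (Fin (m f)) (Fin 3) ℝ)
        (_ : ∀ f, IsUnit ((E f).transpose * E f).det)
        (H : Θ → Matrix (Fin n) (Fin n) ℝ) (_ : ∀ f, H f = featureInfo σ (F f) (E f))
        -- the decomposition used in the definition of the weight spread
        (h : Θ → Fin n → Fin n → ℝ) (_ : IsOrthogonalDecomposition H₀ H h)
        (ε : ℝ) (_ : 0 < ε) (_ : ε < 1)
        (q : ℕ) (_ : C * (n * Real.log n / ε ^ 2) ≤ q) (_ : q < Fintype.card Θ)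
        -- the random samples
        (Ω : Type*) [MeasurableSpace Ω] (P : Measure Ω) [IsProbabilityMeasure P]
        (X : Fin q → Ω → Θ) (_ : ∀ k, Measurable (X k)) (_ : iIndepFun X P)
        (_ : ∀ k f, P.real {ω | X k ω = f} = sampleProb H₀ H f),
        0 < chiBar H₀ H h q ∧
        1 / 4 ≤ P.real {ω |
          (infoMatrix H₀ H (select H₀ H fun k => X k ω).1 -
            ((1 - ε) / (4 * chiBar H₀ H h q)) • infoMatrix H₀ H Finset.univ).PosSemidef} := by
  refine ⟨128, by norm_num, ?_⟩
  intro n hn Θ _ _ _ _ H₀ hH₀ σ hσ m F E hE H hH h hh ε hε hε1 q hq hqN Ω _ P _ X hX hind hlaw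
  classical
  have hHpos : ∀ f, (H f).PosSemidef := fun f => by
    rw [hH]; exact featureInfo_posSemidef σ (F f) (E f) (hE f)
  have hA : (infoMatrix H₀ H Finset.univ).PosDef := infoMatrix_posDef hH₀ hHpos _
  have : Nonempty Θ := Fintype.card_pos_iff.mp (by omega)
  have hn2 : (2 : ℝ) ≤ n := by exact_mod_cast hn
  have hq0 : 0 < q := by
    have : 0 < 128 * (n * Real.log n / ε ^ 2) := by
      have := Real.log_pos (by linarith : (1 : ℝ) < n)
      positivity
    exact_mod_cast this.trans_le hq
  have hqR : (0 : ℝ) < q := by exact_mod_cast hq0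
  have hsum := sum_vecMulVec_eq_infoMatrix hh
  set p : Θ × Fin n → ℝ := fun x => refinedProb H₀ H h x.1 x.2 with hp
  have hp0 : ∀ x, 0 ≤ p x := fun x => refinedProb_nonneg hA _ _
  have hp1 : ∑ x, p x = 1 := by
    have h1 : ∑ x : Θ × Fin n, p x = ((infoMatrix H₀ H Finset.univ)⁻¹ *
        ∑ x : Θ × Fin n, Matrix.vecMulVec (h x.1 x.2) (h x.1 x.2)).trace / n := by
      simp only [hp, refinedProb, refinedLeverage, ← Finset.sum_div, Finset.mul_sum,
        Matrix.trace_sum]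
    rw [h1, hsum, Matrix.nonsing_inv_mul _ (hA.isUnit.map Matrix.detMonoidHom), Matrix.trace_one,
      Fintype.card_fin, div_self (by positivity)]
  -- The law of `q` independent pairs.
  set W : (Fin q → Θ × Fin n) → ℝ := fun s => ∏ k, p (s k) with hW
  have hW0 : ∀ s, 0 ≤ W s := fun s => Finset.prod_nonneg fun k _ => hp0 _
  have hW1 : ∑ s, W s = 1 := by rw [hW, ← Fintype.sum_pow, hp1, one_pow]
  have hchi : chiBar H₀ H h q = ∑ s, W s * chi H₀ H h s := by
    simp only [chiBar, sampleProb_mul_indexProb hA hh, hW, hp]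
  have hchi0 : 0 < chiBar H₀ H h q := by
    obtain ⟨s, -, hs⟩ : ∃ s ∈ Finset.univ, 0 < W s :=
      Finset.exists_lt_of_sum_lt (f := fun _ => (0 : ℝ)) (by simp [hW1])
    rw [hchi]
    refine Finset.sum_pos' (fun s _ => mul_nonneg (hW0 s) (chi_nonneg s))
      ⟨s, Finset.mem_univ s, mul_pos hs (chi_pos hA hq0 fun k => (hp0 (s k)).lt_of_ne' ?_)⟩
    exact Finset.prod_ne_zero_iff.mp hs.ne' k (Finset.mem_univ k)
  refine ⟨hchi0, ?_⟩
  set B : (Fin q → Θ) → Prop := fun s =>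
    (infoMatrix H₀ H (select H₀ H s).1 -
      ((1 - ε) / (4 * chiBar H₀ H h q)) • infoMatrix H₀ H Finset.univ).PosSemidef with hB
  -- The pairs are coupled with the sampled features through their first components.
  have hevent : ∑ s : Fin q → Θ × Fin n with B (fun k => (s k).1), W s ≤
      P.real {ω | B fun k => X k ω} := by
    refine le_trans (le_of_eq ?_) (sum_filter_prod_le_measureReal hX hind B)
    rw [hW, sum_filter_fst_prod p B]
    simp only [hp, sum_refinedProb hh, hlaw]
  refine le_trans ?_ hevent
  set L : (Fin q → Θ × Fin n) → Prop := fun s =>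
    ∀ v : Fin n → ℝ, (1 - ε) * q * (v ⬝ᵥ (infoMatrix H₀ H Finset.univ).mulVec v) ≤
      ∑ k, (p (s k))⁻¹ * (h (s k).1 (s k).2 ⬝ᵥ v) ^ 2 with hL
  have hbadL : ∑ s with ¬ L s, W s ≤ 1 / 2 :=
    sum_filter_not_leverage_lower_bound_le hA hsum
      (fun x => by rw [Fintype.card_fin]; rfl) (by rwa [Fintype.card_fin]) hε hε1
      (by rwa [Fintype.card_fin])
  -- Markov's inequality for `chi`, whose expectation is `chiBar`.
  have hbadChi : ∑ s with 4 * chiBar H₀ H h q ≤ chi H₀ H h s, W s ≤ 1 / 4 := by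
    have h1 := mul_sum_filter_le_sum_mul hW0 (fun s => chi_nonneg (H₀ := H₀) (H := H) (h := h) s)
      (a := 4 * chiBar H₀ H h q) (B := fun s => 4 * chiBar H₀ H h q ≤ chi H₀ H h s) fun s hs => hs
    rw [← hchi] at h1
    refine le_of_mul_le_mul_left (h1.trans_eq ?_) (by positivity : 0 < 4 * chiBar H₀ H h q)
    ring
  have hgood : ∀ s : Fin q → Θ × Fin n, L s → chi H₀ H h s < 4 * chiBar H₀ H h q →
      B fun k => (s k).1 := by
    intro s hLs hs
    refine Matrix.PosSemidef.of_dotProduct_mulVec_nonneg ?_ fun v => ?_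
    · exact (infoMatrix_posDef hH₀ hHpos _).1.sub (hA.posSemidef.smul
        (div_nonneg (by linarith) (by positivity) : 0 ≤ (1 - ε) / (4 * chiBar H₀ H h q))).1
    · rw [star_trivial, Matrix.sub_mulVec, dotProduct_sub, Matrix.smul_mulVec, dotProduct_smul,
        smul_eq_mul, sub_nonneg, div_mul_eq_mul_div, div_le_iff₀ (by positivity)]
      have h1 := hLs v
      rw [← sum_weight_mul_eq, mul_comm (1 - ε), mul_assoc] at h1
      have h2 := le_of_mul_le_mul_left h1 hqR
      have h3 := sum_weight_mul_le_chi_mul (h := h) hA s v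
      have h4 := sum_vecMulVec_quadratic_le hH₀ hh (T := Finset.univ.image s)
        (Φ := (select H₀ H fun k => (s k).1).1) (fun x hx => by
          obtain ⟨k, -, rfl⟩ := Finset.mem_image.mp hx
          exact mem_select H₀ H (fun k => (s k).1) k) v
      calc _ ≤ chi H₀ H h s * ∑ x ∈ Finset.univ.image s, (h x.1 x.2 ⬝ᵥ v) ^ 2 := h2.trans h3
        _ ≤ 4 * chiBar H₀ H h q *
            (v ⬝ᵥ (infoMatrix H₀ H (select H₀ H fun k => (s k).1).1).mulVec v) := by
          gcongr
        _ = _ := mul_comm _ _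
  have hcover : ∑ s, W s ≤ ∑ s : Fin q → Θ × Fin n with B (fun k => (s k).1), W s +
      ∑ s with ¬ L s, W s + ∑ s with 4 * chiBar H₀ H h q ≤ chi H₀ H h s, W s := by
    simp only [Finset.sum_filter, ← Finset.sum_add_distrib]
    refine Finset.sum_le_sum fun s _ => ?_
    have hw := hW0 s
    by_cases h1 : L s
    · by_cases h2 : 4 * chiBar H₀ H h q ≤ chi H₀ H h s
      · simp only [h1, h2, not_true, if_false, if_true]
        split_ifs <;> linarith
      · simp [h1, h2, hgood s h1 (not_le.mp h2)]
    · simp only [h1, not_false_iff, if_true]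
      split_ifs <;> linarith
  rw [hW1] at hcover
  linarith
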